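/- Let $R$ be a commutative Artinian ring and let $E$ be an injective $R$-module. Then the following seven conditions are equivalent: 1. $E$ is Hopfian, that is, every surjective $R$-endomorphism of $E$ is an automorphism; 2. $E$ is co-Hopfian, that is, every injective $R$-endomorphism of $E$ is an automorphism; 3. $E$ is finitely generated; 4. $E$ has finite length, that is, it has a finite composition series; 5. $E$ is Noetherian; 6. $E$ is Artinian; 7. $E$ is finitely cogenerated. Here an $R$-module $M$ is called finitely cogenerated if its injective envelope is isomorphic to the direct sum of the injective envelopes of finitely many (possibly zero) simple $R$-modules. In particular, an injective $R$-module is Hopfian if and only if it is co-Hopfian, and if and only if it is finitely generated. -/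

import Mathlib

open scoped DirectSum

universe u v w

/-- A module is Hopfian if every surjective endomorphism of it is an automorphism. -/
def IsHopfianModule (R : Type u) (M : Type v) [Ring R] [AddCommGroup M] [Module R M] : Prop :=
  ∀ f : M →ₗ[R] M, Function.Surjective f → Function.Bijective f

/-- A module is co-Hopfian if every injective endomorphism of it is an automorphism. -/
def IsCoHopfianModule (R : Type u) (M : Type v) [Ring R] [AddCommGroup M] [Module R M] : Prop :=
  ∀ f : M →ₗ[R] M, Function.Injective f → Function.Bijective f

/-- The linear map `i : M → E` is an injective envelope of `M`: the module `E` is injective and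
`i` is an embedding whose image is an essential submodule of `E`, that is, one that meets every
nonzero submodule of `E` nontrivially. `Module.Injective R E` tests against the modules in the
universe of `E`; this is injectivity as soon as `R` is small in that universe (Baer). -/
structure IsInjectiveEnvelope {R : Type u} {M : Type w} {E : Type v} [Ring R]
    [AddCommGroup M] [Module R M] [AddCommGroup E] [Module R E] (i : M →ₗ[R] E) : Prop where
  injective_module : Module.Injective R E
  injective : Function.Injective i
  essential : ∀ N : Submodule R E, N ⊓ LinearMap.range i = ⊥ → N = ⊥

/-- `F` is an injective envelope of some simple module. -/
def IsInjectiveEnvelopeOfSimple (R : Type u) (F : Type v) [Ring R]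
    [AddCommGroup F] [Module R F] : Prop :=
  ∃ (S : Type v) (_ : AddCommGroup S) (_ : Module R S) (j : S →ₗ[R] F),
    IsSimpleModule R S ∧ IsInjectiveEnvelope j

/-- A module is finitely cogenerated if its injective envelope is isomorphic to the direct sum of
the injective envelopes of finitely many (possibly zero) simple modules. -/
def IsFinitelyCogenerated (R : Type u) (M : Type v) [Ring R]
    [AddCommGroup M] [Module R M] : Prop :=
  ∃ (E : Type v) (_ : AddCommGroup E) (_ : Module R E) (i : M →ₗ[R] E),
    IsInjectiveEnvelope i ∧
      ∃ (n : ℕ) (F : Fin n → Type v) (_ : ∀ k, AddCommGroup (F k)) (_ : ∀ k, Module R (F k)),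
        (∀ k, IsInjectiveEnvelopeOfSimple R (F k)) ∧ Nonempty (E ≃ₗ[R] ⨁ k, F k)

/-! Over a commutative Artinian ring the four finiteness conditions agree (`IsArtinianRing.tfae`),
so the others are compared with "Noetherian". Some product of maximal ideals is zero, hence `E` is
Noetherian once each torsion submodule `E[m]` is. If `E` is injective and co-Hopfian, so is the
`R/m`-vector space `E[m]` co-Hopfian, because its injective endomorphisms extend to injective
endomorphisms of `E`; a co-Hopfian vector space is finite-dimensional. In an envelope of a simple
module, essentiality puts `E[m]` inside that simple module. Conversely, an injective module of
finite length splits into indecomposable injectives, which are uniform by Fitting's lemma and so are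
envelopes of simple submodules. -/

/-! ### Noetherianity from torsion by maximal ideals -/

/-- A module over a commutative Noetherian ring which is torsion by a product of ideals is
Noetherian if its torsion by each factor is. -/
theorem isNoetherian_torsionBySet_multiset_prod {R : Type*} [CommRing R] [IsNoetherianRing R]
    {M : Type*} [AddCommGroup M] [Module R M] (s : Multiset (Ideal R))
    (h : ∀ I ∈ s, IsNoetherian R (Submodule.torsionBySet R M (I : Set R))) :
    IsNoetherian R (Submodule.torsionBySet R M (s.prod : Set R)) := by
  induction s using Multiset.induction with
  | empty =>
    have : Submodule.torsionBySet R M ((0 : Multiset (Ideal R)).prod : Set R) = ⊥ := by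
      rw [Multiset.prod_zero, Ideal.one_eq_top, Submodule.top_coe, Submodule.torsionBySet_univ]
    rw [this]
    infer_instance
  | cons I s ih =>
    have hI := h I (Multiset.mem_cons_self I s)
    have hJ := ih fun J hJ => h J (Multiset.mem_cons_of_mem hJ)
    rw [Multiset.prod_cons]
    generalize s.prod = J at hJ
    obtain ⟨t, ht⟩ := IsNoetherian.noetherian I
    have hmem (a : t) (x : Submodule.torsionBySet R M ((I * J : Ideal R) : Set R)) :
        (a : R) • (x : M) ∈ Submodule.torsionBySet R M (J : Set R) := by
      rw [Submodule.mem_torsionBySet_iff]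
      rintro ⟨b, hb⟩
      have ha : (a : R) ∈ I := ht ▸ Ideal.subset_span a.2
      rw [smul_smul, mul_comm]
      exact (Submodule.mem_torsionBySet_iff _ _).1 x.2 ⟨_, Ideal.mul_mem_mul ha hb⟩
    -- Multiplication by the finitely many generators of `I` lands in a finite power of the
    -- `J`-torsion; its kernel lies in the `I`-torsion.
    let g : Submodule.torsionBySet R M ((I * J : Ideal R) : Set R) →ₗ[R]
        (t → Submodule.torsionBySet R M (J : Set R)) :=
      LinearMap.pi fun a => LinearMap.codRestrict _
        ((LinearMap.lsmul R M (a : R)) ∘ₗ Submodule.subtype _) (hmem a)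
    have hker (x) (hx : x ∈ LinearMap.ker g) :
        (x : M) ∈ Submodule.torsionBySet R M (I : Set R) := by
      have : (I : Set R) = Ideal.span (t : Set R) := by rw [← ht]
      rw [this, Ideal.span, ← Submodule.torsionBySet_eq_torsionBySet_span,
        Submodule.mem_torsionBySet_iff]
      intro a
      exact congrArg Subtype.val (congrFun (LinearMap.mem_ker.1 hx) a)
    have : IsNoetherian R (LinearMap.ker g) :=
      isNoetherian_of_injective
        (LinearMap.codRestrict (Submodule.torsionBySet R M (I : Set R))
          (Submodule.subtype _ ∘ₗ (LinearMap.ker g).subtype) fun x => hker x.1 x.2)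
        fun x y hxy => Subtype.ext (Subtype.ext
          (congrArg (fun z : Submodule.torsionBySet R M (I : Set R) => (z : M)) hxy))
    exact isNoetherian_of_range_eq_ker (LinearMap.ker g).subtype g (Submodule.range_subtype _)

/-- A module over a commutative Artinian ring is Noetherian if its torsion by each maximal ideal
is. -/
theorem isNoetherian_of_forall_isMaximal_torsionBySet {R : Type*} [CommRing R] [IsArtinianRing R]
    {M : Type*} [AddCommGroup M] [Module R M]
    (h : ∀ I : Ideal R, I.IsMaximal → IsNoetherian R (Submodule.torsionBySet R M (I : Set R))) :
    IsNoetherian R M := by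
  obtain ⟨Z, hZ⟩ := PrimeSpectrum.exists_primeSpectrum_prod_le R (⊥ : Ideal R)
  have := isNoetherian_torsionBySet_multiset_prod (M := M) (Z.map PrimeSpectrum.asIdeal) (by
    intro I hI
    obtain ⟨p, -, rfl⟩ := Multiset.mem_map.1 hI
    exact h _ (IsArtinianRing.isMaximal_of_isPrime p.asIdeal))
  rw [le_bot_iff.1 hZ] at this
  have htop : Submodule.torsionBySet R M ((⊥ : Ideal R) : Set R) = ⊤ := by
    rw [eq_top_iff]
    intro x _
    simp
  rw [htop] at this
  exact isNoetherian_of_linearEquiv Submodule.topEquiv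

/-- An infinite-dimensional vector space has an injective endomorphism that is not surjective. -/
theorem IsNoetherian.of_isCoHopfianModule {k V : Type*} [Field k] [AddCommGroup V] [Module k V]
    (h : IsCoHopfianModule k V) : IsNoetherian k V := by
  let b := Module.Basis.ofVectorSpace k V
  rw [IsNoetherian.iff_fg]
  cases finite_or_infinite (Module.Basis.ofVectorSpaceIndex k V) with
  | inl _ => exact Module.Finite.of_basis b
  | inr _ =>
    exfalso
    -- An infinite basis absorbs one extra index; the resulting shift `σ` of the basis misses `e
    -- none`.
    obtain ⟨e⟩ : Nonempty (Option (Module.Basis.ofVectorSpaceIndex k V) ≃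
        Module.Basis.ofVectorSpaceIndex k V) := by
      rw [← Cardinal.eq, Cardinal.mk_option, Cardinal.add_one_eq (Cardinal.aleph0_le_mk _)]
    let σ := fun i => e (some i)
    have hσ : Function.Injective σ := e.injective.comp (Option.some_injective _)
    have hf := (h (b.repr.symm.toLinearMap ∘ₗ Finsupp.lmapDomain k k σ ∘ₗ b.repr.toLinearMap)
      (b.repr.symm.injective.comp ((Finsupp.mapDomain_injective hσ).comp b.repr.injective))).2
    obtain ⟨v, hv⟩ := hf (b (e none))
    have hv' : Finsupp.mapDomain σ (b.repr v) = Finsupp.single (e none) 1 := by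
      rw [← b.repr_self, ← hv]
      exact (b.repr.apply_symm_apply _).symm
    have h0 : Finsupp.mapDomain σ (b.repr v) (e none) = 0 := by
      apply Finsupp.mapDomain_of_notMem_range
      rintro ⟨i, hi⟩
      simpa using e.injective hi
    simp [hv'] at h0

/-- If every injective endomorphism of a module that is torsion by a maximal ideal is an
automorphism, then the module is Noetherian. -/
theorem IsCoHopfianModule.isNoetherian_of_isTorsionBySet {R : Type*} [CommRing R] {M : Type*}
    [AddCommGroup M] [Module R M] [IsNoetherianRing R] (I : Ideal R) [I.IsMaximal]
    (hI : Module.IsTorsionBySet R M (I : Set R)) (h : IsCoHopfianModule R M) :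
    IsNoetherian R M := by
  let _ := Ideal.Quotient.field I
  let _ := hI.module
  have : IsScalarTower R (R ⧸ I) M := hI.isScalarTower
  have : IsNoetherian (R ⧸ I) M :=
    IsNoetherian.of_isCoHopfianModule fun f hf => h (f.restrictScalars R) hf
  have : Module.Finite R M := Module.Finite.trans (R ⧸ I) M
  exact isNoetherian_of_isNoetherianRing_of_finite R M

/-! ### Injectivity and co-Hopfian modules -/

/-- Every submodule `T` is disjoint from some `C` such that `T ⊔ C` is essential. -/
theorem Submodule.exists_disjoint_sup_essential {R M : Type*} [Ring R] [AddCommGroup M]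
    [Module R M] (T : Submodule R M) :
    ∃ C : Submodule R M, Disjoint T C ∧ ∀ K : Submodule R M, Disjoint K (T ⊔ C) → K = ⊥ := by
  obtain ⟨C, hC⟩ := zorn_le₀ {C : Submodule R M | Disjoint T C} (by
    intro c hc hchain
    exact ⟨sSup c, (hchain.directedOn.disjoint_sSup_right).2 fun x hx => hc hx,
      fun x hx => le_sSup hx⟩)
  refine ⟨C, hC.1, fun K hK => ?_⟩
  have h1 : Disjoint T (C ⊔ K) := hC.1.disjoint_sup_right_of_disjoint_sup_left hK.symm
  have h2 : K ≤ C := le_sup_right.trans (hC.2 h1 le_sup_left)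
  exact disjoint_self.1 (hK.mono_right (h2.trans le_sup_right))

/-- Linear maps on two disjoint submodules of `M` to an injective module have a common extension
to `M`. -/
theorem Module.Injective.exists_extend_of_disjoint {R : Type u} [Ring R] {M E : Type v}
    [AddCommGroup M] [Module R M] [AddCommGroup E] [Module R E] [Module.Injective R E]
    {S T : Submodule R M} (h : Disjoint S T) (f : S →ₗ[R] E) (g : T →ₗ[R] E) :
    ∃ e : M →ₗ[R] E, (∀ x : S, e x = f x) ∧ ∀ x : T, e x = g x := by
  obtain ⟨e, he⟩ := Module.Injective.out (S.subtype.coprod T.subtype)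
    (by
      rw [← LinearMap.ker_eq_bot, LinearMap.ker_coprod_of_disjoint_range _ _ (by simpa using h)]
      simp) (f.coprod g)
  exact ⟨e, fun x => by simpa using he (x, 0), fun x => by simpa using he (0, x)⟩

/-- A direct summand of an injective module is injective. -/
theorem Module.Injective.of_isCompl {R : Type u} [Ring R] {M : Type v}
    [AddCommGroup M] [Module R M] [Module.Injective R M] {F G : Submodule R M}
    (h : IsCompl F G) : Module.Injective R F where
  out X Y _ _ _ _ f hf g := by
    obtain ⟨e, he⟩ := Module.Injective.out f hf (F.subtype ∘ₗ g)
    exact ⟨F.projectionOnto G h ∘ₗ e, fun x => by simp [he]⟩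

/-- By injectivity an injective `f` has a retraction, which is surjective and hence bijective, so
`f` is its inverse. -/
theorem IsHopfianModule.isCoHopfianModule {R : Type u} [Ring R] {E : Type v} [AddCommGroup E]
    [Module R E] [Module.Injective R E] (h : IsHopfianModule R E) : IsCoHopfianModule R E := by
  intro f hf
  obtain ⟨r, hr⟩ := Module.Injective.out f hf LinearMap.id
  have hrb := h r fun x => ⟨f x, hr x⟩
  exact ⟨hf, fun y => ⟨r y, hrb.1 (hr (r y))⟩⟩

/-- The torsion of a co-Hopfian injective module by an ideal is co-Hopfian. -/
theorem IsCoHopfianModule.torsionBySet {R : Type u} [CommRing R] {E : Type v}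
    [AddCommGroup E] [Module R E] [Module.Injective R E] (h : IsCoHopfianModule R E)
    (s : Set R) : IsCoHopfianModule R (Submodule.torsionBySet R E s) := by
  intro f hf
  refine ⟨hf, fun x => ?_⟩
  obtain ⟨C, hC, hess⟩ := (Submodule.torsionBySet R E s).exists_disjoint_sup_essential
  -- Extending by the identity on `C` keeps `g` injective on the essential submodule `T ⊔ C`, where
  -- `T` is the torsion, since `f` maps into `T`. So `ker g` vanishes.
  obtain ⟨g, hgf, hgC⟩ :=
    Module.Injective.exists_extend_of_disjoint hC (Submodule.subtype _ ∘ₗ f) C.subtype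
  simp only [LinearMap.comp_apply, Submodule.subtype_apply] at hgf hgC
  have hinj : Function.Injective g := by
    rw [← LinearMap.ker_eq_bot]
    apply hess
    rw [Submodule.disjoint_def]
    intro z hz hz'
    obtain ⟨a, ha, c, hc, rfl⟩ := Submodule.mem_sup.1 hz'
    have h0 : (f ⟨a, ha⟩ : E) + c = 0 := by
      have := hgf ⟨a, ha⟩
      have := hgC ⟨c, hc⟩
      simp_all
    have hc0 : c = 0 := by
      refine Submodule.disjoint_def.1 hC c ?_ hc
      rw [← neg_eq_of_add_eq_zero_right h0]
      exact neg_mem (f _).2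
    have ha0 : f ⟨a, ha⟩ = 0 := by simpa [hc0] using h0
    have := (map_eq_zero_iff f hf).1 ha0
    simp_all
  obtain ⟨y, hy⟩ := (h g hinj).2 x
  have hyT : y ∈ Submodule.torsionBySet R E s := by
    rw [Submodule.mem_torsionBySet_iff]
    intro a
    apply hinj
    rw [map_smul, hy, map_zero]
    exact (Submodule.mem_torsionBySet_iff _ _).1 x.2 a
  exact ⟨⟨y, hyT⟩, Subtype.ext ((hgf ⟨y, hyT⟩).symm.trans hy)⟩

theorem IsCoHopfianModule.isNoetherian {R : Type u} [CommRing R] [IsArtinianRing R] {E : Type v}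
    [AddCommGroup E] [Module R E] [Module.Injective R E] (h : IsCoHopfianModule R E) :
    IsNoetherian R E :=
  isNoetherian_of_forall_isMaximal_torsionBySet fun I _ =>
    (h.torsionBySet I).isNoetherian_of_isTorsionBySet I (Submodule.torsionBySet_isTorsionBySet _)

/-! ### Finitely cogenerated modules -/

/-- An injective envelope of a simple module over a commutative Artinian ring is Noetherian. -/
theorem IsInjectiveEnvelopeOfSimple.isNoetherian {R : Type u} [CommRing R] [IsArtinianRing R]
    {F : Type v} [AddCommGroup F] [Module R F] (h : IsInjectiveEnvelopeOfSimple R F) :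
    IsNoetherian R F := by
  obtain ⟨S, _, _, j, hS, hj⟩ := h
  refine isNoetherian_of_forall_isMaximal_torsionBySet fun I _ => ?_
  have hss : IsSemisimpleModule R (Submodule.torsionBySet R F (I : Set R)) := by
    let _ := Ideal.Quotient.field I
    rw [← (Submodule.torsionBySet_isTorsionBySet (R := R) (M := F) (I : Set R)).isSemisimpleModule_iff]
    infer_instance
  -- The complement `C` misses the range of `j`, so essentiality forces `C = ⊥`.
  obtain ⟨C, hC⟩ := exists_isCompl
    ((LinearMap.range j).comap (Submodule.torsionBySet R F (I : Set R)).subtype)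
  have hC0 : C = ⊥ := by
    apply Submodule.map_injective_of_injective (Submodule.subtype_injective _)
    rw [Submodule.map_bot]
    apply hj.essential
    rw [eq_bot_iff]
    rintro _ ⟨⟨x, hx, rfl⟩, hxj⟩
    simpa using Submodule.disjoint_def.1 hC.disjoint x hxj hx
  have hle : Submodule.torsionBySet R F (I : Set R) ≤ LinearMap.range j := by
    have := hC.sup_eq_top
    rwa [hC0, sup_bot_eq, Submodule.comap_subtype_eq_top] at this
  exact isNoetherian_of_le hle

theorem IsFinitelyCogenerated.isNoetherian {R : Type u} [CommRing R] [IsArtinianRing R]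
    {M : Type v} [AddCommGroup M] [Module R M] (h : IsFinitelyCogenerated R M) :
    IsNoetherian R M := by
  obtain ⟨E, _, _, i, hi, n, F, _, _, hF, ⟨e⟩⟩ := h
  have := fun k => (hF k).isNoetherian
  have : IsNoetherian R E :=
    isNoetherian_of_linearEquiv (e.trans (DirectSum.linearEquivFunOnFintype R (Fin n) F)).symm
  exact isNoetherian_of_injective i hi.injective

/-- An indecomposable injective module of finite length is uniform. -/
theorem Module.Injective.eq_bot_or_eq_bot_of_disjoint {R : Type u} [Ring R] {M : Type v}
    [AddCommGroup M] [Module R M] [Module.Injective R M] [IsNoetherian R M] [IsArtinian R M]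
    (hM : ∀ A B : Submodule R M, IsCompl A B → A = ⊥ ∨ B = ⊥) {S N : Submodule R M}
    (h : Disjoint S N) : S = ⊥ ∨ N = ⊥ := by
  obtain ⟨e, heS, heN⟩ := exists_extend_of_disjoint h S.subtype (0 : N →ₗ[R] M)
  -- Fitting's lemma; the exponent `n + 1` is positive, so that the power kills `N`.
  obtain ⟨n, hn⟩ := Filter.eventually_atTop.1 (LinearMap.eventually_isCompl_ker_pow_range_pow e)
  have hc := hn (n + 1) n.le_succ
  have hS : S ≤ LinearMap.range (e ^ (n + 1)) := by
    intro x hx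
    refine ⟨x, ?_⟩
    rw [Module.End.pow_apply]
    exact Function.IsFixedPt.iterate (heS ⟨x, hx⟩) _
  have hN : N ≤ LinearMap.ker (e ^ (n + 1)) := by
    intro x hx
    have : e x = 0 := heN ⟨x, hx⟩
    rw [LinearMap.mem_ker, pow_succ, Module.End.mul_apply, this, map_zero]
  rcases hM _ _ hc with h' | h'
  · exact .inr (le_bot_iff.1 (h' ▸ hN))
  · exact .inl (le_bot_iff.1 (h' ▸ hS))

/-- A direct summand of an injective module of finite length that is minimal among the nonzero
direct summands is an injective envelope of a simple module. -/
theorem isInjectiveEnvelopeOfSimple_of_minimal {R : Type u} [Ring R] {E : Type v}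
    [AddCommGroup E] [Module R E] [Module.Injective R E] [IsNoetherian R E] [IsArtinian R E]
    {F : Submodule R E} (hF : Minimal (fun F : Submodule R E => F ≠ ⊥ ∧ IsComplemented F) F) :
    IsInjectiveEnvelopeOfSimple R F := by
  obtain ⟨⟨hF0, G, hFG⟩, hmin⟩ := hF
  have := Module.Injective.of_isCompl hFG
  have hindec (A B : Submodule R F) (hAB : IsCompl A B) : A = ⊥ ∨ B = ⊥ := by
    by_contra! hne
    -- A summand of `F` is a summand of `E`, so minimality of `F` applies to `A`.
    have hA : IsCompl (A.map F.subtype) (B.map F.subtype ⊔ G) := by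
      have hd : Disjoint (A.map F.subtype) (B.map F.subtype) :=
        (Submodule.disjoint_map (Submodule.subtype_injective F)) hAB.disjoint
      have hs : A.map F.subtype ⊔ B.map F.subtype = F := by
        rw [← Submodule.map_sup, hAB.sup_eq_top, Submodule.map_subtype_top]
      constructor
      · exact hd.disjoint_sup_right_of_disjoint_sup_left (hs.symm ▸ hFG.disjoint)
      · rw [codisjoint_iff, ← sup_assoc, hs, hFG.sup_eq_top]
    have hle := hmin ⟨fun h => hne.1
      (Submodule.map_injective_of_injective (Submodule.subtype_injective F)
        (h.trans (Submodule.map_bot _).symm)), _, hA⟩ (Submodule.map_subtype_le F A)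
    have hAtop : A = ⊤ := by
      rw [eq_top_iff]
      intro x _
      obtain ⟨a, ha, hax⟩ := hle x.2
      exact Subtype.ext hax ▸ ha
    exact hne.2 (by simpa [hAtop] using hAB.inf_eq_bot)
  have : Nontrivial F := Submodule.nontrivial_iff_ne_bot.2 hF0
  obtain ⟨S, hS, -⟩ := (eq_bot_or_exists_atom_le (⊤ : Submodule R F)).resolve_left top_ne_bot
  refine ⟨S, inferInstance, inferInstance, S.subtype, isSimpleModule_iff_isAtom.2 hS,
    ‹_›, Submodule.subtype_injective S, fun N hN => ?_⟩
  rw [Submodule.range_subtype, ← disjoint_iff] at hN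
  exact (Module.Injective.eq_bot_or_eq_bot_of_disjoint hindec hN).resolve_right hS.1

/-- An injective module of finite length is an internal direct sum of injective envelopes of
simple modules. -/
theorem exists_supIndep_isInjectiveEnvelopeOfSimple (R : Type u) [Ring R] (E : Type v)
    [AddCommGroup E] [Module R E] [Module.Injective R E] [IsNoetherian R E] [IsArtinian R E] :
    ∃ s : Finset (Submodule R E), s.SupIndep id ∧ s.sup id = ⊤ ∧
      ∀ F ∈ s, IsInjectiveEnvelopeOfSimple R F := by
  classical
  -- Take a minimal complement `C` of a finite direct sum of envelopes; if `C` is nonzero, a further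
  -- envelope `F` splits off it.
  obtain ⟨C, ⟨s, hs, hsC, hsF⟩, hmin⟩ := exists_minimal_of_wellFoundedLT
    (fun C : Submodule R E => ∃ s : Finset (Submodule R E), s.SupIndep id ∧
      IsCompl (s.sup id) C ∧ ∀ F ∈ s, IsInjectiveEnvelopeOfSimple R F)
    ⟨⊤, ∅, Finset.supIndep_empty _, by simpa using isCompl_bot_top, by simp⟩
  rcases eq_or_ne C ⊥ with rfl | hC
  · exact ⟨s, hs, by simpa using hsC.sup_eq_top, hsF⟩
  obtain ⟨F, hFC, hF⟩ := exists_minimal_le_of_wellFoundedLT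
    (fun F : Submodule R E => F ≠ ⊥ ∧ IsComplemented F) C ⟨hC, _, hsC.symm⟩
  obtain ⟨G, hFG⟩ := hF.1.2
  -- By the modular law, `C ⊓ G` is what remains of `C` after removing `F`.
  have hsup : F ⊔ (C ⊓ G) = C := by
    rw [inf_comm, ← sup_inf_assoc_of_le G hFC, hFG.sup_eq_top, top_inf_eq]
  have hdF : Disjoint F (s.sup id) := (hsC.disjoint.mono_right hFC).symm
  have hcompl : IsCompl ((insert F s).sup id) (C ⊓ G) := by
    rw [Finset.sup_insert, id, sup_comm]
    constructor
    · refine Disjoint.disjoint_sup_left_of_disjoint_sup_right ?_ ?_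
      · exact hFG.disjoint.mono_right inf_le_right
      · rw [hsup]
        exact hsC.disjoint
    · rw [codisjoint_iff, sup_assoc, hsup, hsC.sup_eq_top]
  have hle := hmin ⟨insert F s, hs.insert hdF, hcompl, by
    intro F' hF'
    rcases Finset.mem_insert.1 hF' with rfl | h
    · exact isInjectiveEnvelopeOfSimple_of_minimal hF
    · exact hsF _ h⟩ inf_le_left
  exact absurd (hFG.disjoint.eq_bot_of_le (hFC.trans (hle.trans inf_le_right))) hF.1.1

theorem Module.Injective.isFinitelyCogenerated (R : Type u) [Ring R] (E : Type v)
    [AddCommGroup E] [Module R E] [Module.Injective R E] [IsNoetherian R E] [IsArtinian R E] :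
    IsFinitelyCogenerated R E := by
  classical
  obtain ⟨s, hs, hsup, hsF⟩ := exists_supIndep_isInjectiveEnvelopeOfSimple R E
  -- An injective module is its own injective envelope.
  refine ⟨E, inferInstance, inferInstance, LinearMap.id,
    ⟨‹_›, Function.injective_id, fun N hN => by simpa using hN⟩, s.card,
    fun k => (s.equivFin.symm k : Submodule R E), inferInstance, inferInstance,
    fun k => hsF _ (s.equivFin.symm k).2, ⟨?_⟩⟩
  have hind : iSupIndep fun k => (s.equivFin.symm k : Submodule R E) :=
    hs.independent.comp s.equivFin.symm.injective
  have htop : ⨆ k, (s.equivFin.symm k : Submodule R E) = ⊤ := by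
    rw [s.equivFin.symm.surjective.iSup_comp (fun F : s => (F : Submodule R E)), ← hsup,
      Finset.sup_eq_iSup, iSup_subtype]
    rfl
  exact (LinearEquiv.ofBijective (DirectSum.coeLinearMap _)
    (DirectSum.isInternal_submodule_of_iSupIndep_of_iSup_eq_top hind htop)).symm

theorem theorem3p5 (R : Type u) [CommRing R] [IsArtinianRing R] [Small.{v} R]
    (E : Type v) [AddCommGroup E] [Module R E] [Module.Injective R E] :
    List.TFAE [
      IsHopfianModule R E,
      IsCoHopfianModule R E,
      Module.Finite R E,
      IsFiniteLength R E,
      IsNoetherian R E,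
      IsArtinian R E,
      IsFinitelyCogenerated R E] := by
  have key := IsArtinianRing.tfae R E
  tfae_have 1 → 2 := IsHopfianModule.isCoHopfianModule
  tfae_have 2 → 5 := IsCoHopfianModule.isNoetherian
  tfae_have 5 → 1 := fun _ f hf => IsNoetherian.bijective_of_surjective_endomorphism f hf
  tfae_have 3 ↔ 5 := key.out 0 1
  tfae_have 4 ↔ 5 := key.out 3 1
  tfae_have 6 ↔ 5 := key.out 2 1
  tfae_have 7 → 5 := IsFinitelyCogenerated.isNoetherian
  tfae_have 5 → 7 := fun h =>
    have := (key.out 1 2).1 h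
    Module.Injective.isFinitelyCogenerated R E
  tfae_finish
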